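/- Let $n,k,l\ge 1$ be integers and let $A_{k,l}=(-\Delta)^l+|x|^{2k}+1$ be the anharmonic oscillator on $\mathbb R^n$. Let $(u_j)_{j\in\mathbb N}$ be an orthonormal basis of $L^2(\mathbb R^n)$ consisting of eigenfunctions of $A_{k,l}$, and write $\mathcal F_{A_{k,l}}f(j)=\int_{\mathbb R^n} f(x)\overline{u_j(x)}\,dx$. Let $1<p\le 2$, let $p'=\frac{p}{p-1}$, and let $p\le b\le p'$. Let $\varphi:\mathbb N\to(0,\infty)$ be a positive sequence such that $$M_\varphi:=\sup_{t>0}\, t\sum_{\substack{j\in\mathbb N\\ t\le\varphi(j)}}\|u_j\|_{L^\infty(\mathbb R^n)}^2<\infty .$$ Then for every $f\in L^p(\mathbb R^n)$ the integrals defining $\mathcal F_{A_{k,l}}f(j)$ converge absolutely, and $$\Bigl(\sum_{j\in\mathbb N}\bigl(|\mathcal F_{A_{k,l}}f(j)|\,\varphi(j)^{\frac1b-\frac1{p'}}\bigr)^b\,\|u_j\|_{L^\infty(\mathbb R^n)}^{2-b}\Bigr)^{1/b}\le C_p\, M_\varphi^{\frac1b-\frac1{p'}}\,\|f\|_{L^p(\mathbb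 R^n)},$$ where the constant $C_p$ depends only on $p$. -/

import Mathlib

open MeasureTheory
open scoped ENNReal NNReal SchwartzMap Laplacian

/-- Euclidean space of dimension `n`. -/
abbrev Rn (n : ℕ) : Type := EuclideanSpace ℝ (Fin n)

/-- The potential `x ↦ |x|^{2k}`, as a complex-valued function. -/
noncomputable def potential (n k : ℕ) (x : Rn n) : ℂ := ((‖x‖ ^ (2 * k) : ℝ) : ℂ)

/-- The potential is smooth of at most polynomial growth, so that multiplication by it is a genuine
operation on Schwartz functions and on tempered distributions. -/
theorem potential_hasTemperateGrowth (n k : ℕ) : (potential n k).HasTemperateGrowth := by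
  have h1 : (fun x : Rn n => ‖x‖ ^ 2).HasTemperateGrowth :=
    Function.hasTemperateGrowth_norm_sq (H := Rn n)
  have h2 := Function.HasTemperateGrowth.comp Function.Complex.hasTemperateGrowth_ofReal (h1.pow k)
  have h3 : potential n k = Complex.ofReal ∘ ((fun x : Rn n => ‖x‖ ^ 2) ^ k) := by
    funext x
    simp [potential, pow_mul]
  rw [h3]
  exact h2

/-- The anharmonic oscillator `A_{k,l} = (-Δ)^l + |x|^{2k} + 1`, acting on tempered
distributions on `ℝⁿ`. -/
noncomputable def anharmonicOscillator (n k l : ℕ) (T : 𝓢'(Rn n, ℂ)) : 𝓢'(Rn n, ℂ) :=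
  (fun S : 𝓢'(Rn n, ℂ) => -(Δ S))^[l] T
    + TemperedDistribution.smulLeftCLM ℂ (potential n k) T + T

/-- `g ∈ L²(ℝⁿ)` satisfies `A_{k,l} g = lam g` (in the sense of distributions; in particular
`A_{k,l} g ∈ L²`, so that `g` is in the domain of the self-adjoint realization of `A_{k,l}` on
`L²(ℝⁿ)`). The function `g` is an eigenfunction if it is moreover nonzero. -/
def SatisfiesEigenEquation (n k l : ℕ) (g : Lp ℂ 2 (volume : Measure (Rn n))) (lam : ℝ) : Prop :=
  anharmonicOscillator n k l (Lp.toTemperedDistribution g)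
    = (lam : ℂ) • Lp.toTemperedDistribution g

/-- `u` is an orthonormal basis of `L²(ℝⁿ)` consisting of eigenfunctions of `A_{k,l}`. -/
def IsEigenbasis (n k l : ℕ) (u : HilbertBasis ℕ ℂ (Lp ℂ 2 (volume : Measure (Rn n)))) : Prop :=
  ∃ lam : ℕ → ℝ, ∀ j, SatisfiesEigenEquation n k l (u j) (lam j)

/-- The coefficient `∫ f(x) conj(g(x)) dx`. For `g = u j` this is the value at `j` of the Fourier
transform of `f` associated with `A_{k,l}`. -/
noncomputable def fourierCoefficient {n : ℕ} (g : Lp ℂ 2 (volume : Measure (Rn n)))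
    (f : Rn n → ℂ) : ℂ :=
  ∫ x, f x * (starRingEnd ℂ) (g x)

/-- The norm of `g` in `L^∞(ℝⁿ)`, possibly infinite. -/
noncomputable def supNorm {n : ℕ} (g : Lp ℂ 2 (volume : Measure (Rn n))) : ℝ≥0∞ :=
  eLpNorm g ∞ volume

/-- `M_φ = sup_{t > 0} t ∑_{j : t ≤ φ j} ‖u j‖_∞²`, possibly infinite. -/
noncomputable def paleyConstant {n : ℕ} (u : ℕ → Lp ℂ 2 (volume : Measure (Rn n)))
    (φ : ℕ → ℝ) : ℝ≥0∞ :=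
  ⨆ (t : ℝ) (_ : 0 < t), ENNReal.ofReal t * ∑' j : {j : ℕ // t ≤ φ j}, supNorm (u j) ^ 2

/-! What carries the argument is that the `u j` are orthonormal and bounded; boundedness is read off
from the finite Paley constant M. Write c_j for the coefficients, B_j for the sup norms, N = ∫|f|^p
and q = p'. Two bounds are available: |c_j| ≤ B_j ‖f‖_1 and Bessel's inequality. For p < 2, both
endpoints come from real interpolation in the style of Marcinkiewicz, with f cut at a height
depending on the level t. For b = q (`tsum_hausdorffYoung_le`) the operator is f ↦ c_j / B_j into ℕ
with weight B_j^2, of type (1, ∞) and (2, 2). For b = p (`tsum_paley_le`) it is f ↦ c_j / (φ_j B_j)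
with weight (φ_j B_j)^2, of type (2, 2) and weak type (1, 1); the latter is where M enters, through
`tsum_indicator_le_paleyConstant_mul`. Hölder's inequality between the two sums gives every b in
between (`tsum_paley_interpolation_le`). The endpoint constants degenerate at p = 2, where b = 2 and
the claim is Bessel's inequality. -/

/-! ### Layer cake and power integrals. -/

/-- Layer cake formula for weighted sums. -/
theorem tsum_mul_ofReal_rpow_eq_lintegral (w : ℕ → ℝ≥0∞) (g : ℕ → ℝ) (hg : ∀ j, 0 ≤ g j)
    {q : ℝ} (hq : 0 < q) :
    ∑' j, w j * ENNReal.ofReal (g j ^ q) = ENNReal.ofReal q *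
      ∫⁻ t in Set.Ioi (0 : ℝ),
        (∑' j, {j | t < g j}.indicator w j) * ENNReal.ofReal (t ^ (q - 1)) := by
  -- The weighted sum is an integral against counting measure with density `w`.
  have h := lintegral_rpow_eq_lintegral_meas_lt_mul (Measure.count.withDensity w)
    (f := g) (Filter.Eventually.of_forall hg) (by fun_prop) hq
  rw [lintegral_withDensity_eq_lintegral_mul _ (by fun_prop) (by fun_prop),
    lintegral_count] at h
  simp only [Pi.mul_apply] at h
  rw [h]
  congr 1
  refine lintegral_congr fun t => ?_
  rw [withDensity_apply _ (MeasurableSet.of_discrete), ← lintegral_indicator MeasurableSet.of_discrete,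
    lintegral_count]

theorem lintegral_Ioc_rpow {r a : ℝ} (hr : -1 < r) (ha : 0 ≤ a) :
    ∫⁻ t in Set.Ioc 0 a, ENNReal.ofReal (t ^ r) = ENNReal.ofReal (a ^ (r + 1) / (r + 1)) := by
  rw [← ofReal_integral_eq_lintegral_ofReal]
  · rw [← intervalIntegral.integral_of_le ha, integral_rpow (Or.inl hr),
      Real.zero_rpow (by linarith), sub_zero]
  · exact (intervalIntegrable_iff_integrableOn_Ioc_of_le ha).1
      (intervalIntegral.intervalIntegrable_rpow' hr)
  · filter_upwards [self_mem_ae_restrict measurableSet_Ioc] with t ht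
    exact Real.rpow_nonneg ht.1.le _

theorem lintegral_Ioi_rpow {r c : ℝ} (hr : r < -1) (hc : 0 < c) :
    ∫⁻ t in Set.Ioi c, ENNReal.ofReal (t ^ r) = ENNReal.ofReal (-c ^ (r + 1) / (r + 1)) := by
  rw [← ofReal_integral_eq_lintegral_ofReal, integral_Ioi_rpow_of_lt hr hc]
  · exact integrableOn_Ioi_rpow_of_lt hr hc
  · filter_upwards [self_mem_ae_restrict measurableSet_Ioi] with t ht
    exact Real.rpow_nonneg (hc.trans ht).le _

/-- Tonelli's theorem over a measurable region of `(0, ∞) × X`. -/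
theorem lintegral_setLIntegral_mul_swap {X : Type*} [MeasurableSpace X] {μ : Measure X} [SFinite μ]
    {E : Set (ℝ × X)} (hE : MeasurableSet E) {h : X → ℝ≥0∞} (hh : Measurable h)
    {k : ℝ → ℝ≥0∞} (hk : Measurable k) :
    ∫⁻ t in Set.Ioi (0 : ℝ), (∫⁻ x in {x | (t, x) ∈ E}, h x ∂μ) * k t =
      ∫⁻ x, h x * (∫⁻ t in {t | 0 < t ∧ (t, x) ∈ E}, k t) ∂μ := by
  have h1 : ∀ t, (∫⁻ x in {x | (t, x) ∈ E}, h x ∂μ) * k t =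
      ∫⁻ x, E.indicator (fun z => h z.2 * k z.1) (t, x) ∂μ := fun t => by
    have hm : MeasurableSet {x | (t, x) ∈ E} := measurable_prodMk_left hE
    rw [← lintegral_mul_const _ hh, ← lintegral_indicator hm]
    rfl
  have h2 : ∀ x, h x * ∫⁻ t in {t | 0 < t ∧ (t, x) ∈ E}, k t =
      ∫⁻ t in Set.Ioi (0 : ℝ), E.indicator (fun z => h z.2 * k z.1) (t, x) := fun x => by
    have hm : MeasurableSet {t | (t, x) ∈ E} := measurable_prodMk_right hE
    have he : {t | 0 < t ∧ (t, x) ∈ E} = {t | (t, x) ∈ E} ∩ Set.Ioi 0 := by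
      ext t; simp [and_comm]
    rw [he, ← lintegral_const_mul _ hk, ← Measure.restrict_restrict hm, ← lintegral_indicator hm]
    rfl
  simp_rw [h1, h2]
  refine lintegral_lintegral_swap (Measurable.aemeasurable ?_)
  exact Measurable.indicator (by fun_prop) hE

/-! ### Size and integrability of the coefficients. -/

section Coefficients

variable {n : ℕ}

theorem fourierCoefficient_congr (g : Lp ℂ 2 (volume : Measure (Rn n))) {f f' : Rn n → ℂ}
    (h : f =ᵐ[volume] f') : fourierCoefficient g f = fourierCoefficient g f' :=
  integral_congr_ae (by filter_upwards [h] with x hx; rw [hx])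

/-- The coefficients are bounded on `L¹`. -/
theorem enorm_fourierCoefficient_le (g : Lp ℂ 2 (volume : Measure (Rn n))) {f : Rn n → ℂ}
    (hf : AEStronglyMeasurable f volume) :
    ‖fourierCoefficient g f‖ₑ ≤ supNorm g * ∫⁻ x, ‖f x‖ₑ := by
  refine (enorm_integral_le_lintegral_enorm _).trans ?_
  rw [← lintegral_const_mul'' _ hf.enorm]
  refine lintegral_mono_ae ?_
  filter_upwards [ae_le_eLpNormEssSup (f := g) (μ := volume)] with x hx
  rw [enorm_mul, mul_comm]
  gcongr
  simpa [supNorm] using hx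

/-- Bessel's inequality for the coefficients. -/
theorem tsum_enorm_fourierCoefficient_sq_le {u : ℕ → Lp ℂ 2 (volume : Measure (Rn n))}
    (hu : Orthonormal ℂ u) {f : Rn n → ℂ} (hf : AEStronglyMeasurable f volume) :
    ∑' j, ‖fourierCoefficient (u j) f‖ₑ ^ 2 ≤ ∫⁻ x, ‖f x‖ₑ ^ 2 := by
  have hN : eLpNorm f 2 volume ^ 2 = ∫⁻ x, ‖f x‖ₑ ^ 2 := by
    have := eLpNorm_nnreal_pow_eq_lintegral (f := f) (μ := (volume : Measure (Rn n))) (p := 2)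
      (by norm_num)
    simpa using this
  by_cases htop : ∫⁻ x, ‖f x‖ₑ ^ 2 = ∞
  · rw [htop]; exact le_top
  have hf2 : MemLp f 2 volume := by
    refine ⟨hf, lt_top_iff_ne_top.2 fun h => htop ?_⟩
    rw [← hN, h]; rfl
  have hc : ∀ j, fourierCoefficient (u j) f = inner ℂ (u j) hf2.toLp := fun j => by
    rw [L2.inner_def]
    refine integral_congr_ae ?_
    filter_upwards [hf2.coeFn_toLp] with x hx
    simp [hx]
  rw [← hN, ENNReal.tsum_eq_iSup_sum]
  refine iSup_le fun s => ?_
  have hs := hu.sum_inner_products_le hf2.toLp (s := s)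
  have he : ∀ j, ‖fourierCoefficient (u j) f‖ₑ ^ 2
      = ENNReal.ofReal (‖inner ℂ (u j) hf2.toLp‖ ^ 2) := fun j => by
    rw [hc, ← ofReal_norm, ENNReal.ofReal_pow (norm_nonneg _)]
  rw [Finset.sum_congr rfl fun j _ => he j,
    ← ENNReal.ofReal_sum_of_nonneg fun _ _ => by positivity]
  refine (ENNReal.ofReal_le_ofReal hs).trans_eq ?_
  rw [Lp.norm_toLp, ENNReal.ofReal_pow ENNReal.toReal_nonneg, ENNReal.ofReal_toReal hf2.2.ne]

/-- A bounded function of `L²` pairs integrably with all of `L^p` for `1 ≤ p ≤ 2`. -/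
theorem integrable_mul_conj_of_supNorm_lt_top {g : Lp ℂ 2 (volume : Measure (Rn n))}
    (hg : supNorm g < ∞) {p : ℝ} (hp1 : 1 < p) (hp2 : p ≤ 2) {f : Rn n → ℂ}
    (hf : MemLp f (ENNReal.ofReal p) volume) :
    Integrable (fun x => f x * (starRingEnd ℂ) (g x)) volume := by
  refine ⟨hf.1.mul (Complex.continuous_conj.comp_aestronglyMeasurable (Lp.memLp g).1), ?_⟩
  have hfp : ∫⁻ x, ‖f x‖ₑ ^ p < ∞ := by
    have := lintegral_rpow_enorm_lt_top_of_eLpNorm_lt_top (by simp; linarith) (by simp) hf.2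
    rwa [ENNReal.toReal_ofReal (by linarith)] at this
  have hg2 : ∫⁻ x, ‖g x‖ₑ ^ (2 : ℝ) < ∞ := by
    have := lintegral_rpow_enorm_lt_top_of_eLpNorm_lt_top (by simp) (by simp) (Lp.memLp g).2
    simpa using this
  -- Pointwise majorant: where |f| ≥ 1 use |f| ≤ |f|^p and the bound on g; where |f| ≤ 1 use |f||g|
  -- ≤ |f|^2 + |g|^2 and |f|^2 ≤ |f|^p.
  refine lt_of_le_of_lt (b := ∫⁻ x, (supNorm g + 1) * ‖f x‖ₑ ^ p + ‖g x‖ₑ ^ (2 : ℝ))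
    (lintegral_mono_ae ?_) ?_
  · filter_upwards [ae_le_eLpNormEssSup (f := g) (μ := volume)] with x hx
    have hx' : ‖g x‖ₑ ≤ supNorm g := by simpa [supNorm] using hx
    rw [enorm_mul, RCLike.enorm_conj]
    rcases le_total 1 ‖f x‖ₑ with h1 | h1
    · calc ‖f x‖ₑ * ‖g x‖ₑ ≤ ‖f x‖ₑ ^ p * supNorm g := by
            gcongr
            simpa using ENNReal.rpow_le_rpow_of_exponent_le h1 hp1.le
        _ ≤ _ := by
            rw [mul_comm, add_mul, add_assoc]
            exact le_self_add
    · have h2 : ‖f x‖ₑ ^ (2 : ℝ) ≤ ‖f x‖ₑ ^ p := ENNReal.rpow_le_rpow_of_exponent_ge h1 hp2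
      calc ‖f x‖ₑ * ‖g x‖ₑ ≤ ‖f x‖ₑ ^ (2 : ℝ) + ‖g x‖ₑ ^ (2 : ℝ) := by
            simp only [ENNReal.rpow_two]
            rcases le_total ‖f x‖ₑ ‖g x‖ₑ with h | h
            · exact (mul_le_mul_left h _).trans (by rw [← sq]; exact le_add_self)
            · exact (mul_le_mul_right h _).trans (by rw [← sq]; exact le_self_add)
        _ ≤ _ := by
            gcongr
            refine h2.trans ?_
            rw [add_mul, one_mul]
            exact le_add_self
  · rw [lintegral_add_right' _ ((Lp.memLp g).1.enorm.pow_const _),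
      lintegral_const_mul'' _ (hf.1.enorm.pow_const _)]
    exact ENNReal.add_lt_top.2 ⟨ENNReal.mul_lt_top (by simp [hg]) hfp, hg2⟩

/-- Splitting a function over a set and its complement. -/
theorem enorm_fourierCoefficient_le_indicator_add {g : Lp ℂ 2 (volume : Measure (Rn n))}
    {f : Rn n → ℂ} (hf : Integrable (fun x => f x * (starRingEnd ℂ) (g x)) volume)
    {S : Set (Rn n)} (hS : MeasurableSet S) :
    ‖fourierCoefficient g f‖ₑ ≤ ‖fourierCoefficient g (S.indicator f)‖ₑ +
      ‖fourierCoefficient g (Sᶜ.indicator f)‖ₑ := by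
  have h : ∀ T : Set (Rn n), MeasurableSet T → fourierCoefficient g (T.indicator f) =
      ∫ x in T, f x * (starRingEnd ℂ) (g x) := fun T hT => by
    rw [← integral_indicator hT]
    refine integral_congr_ae (Filter.Eventually.of_forall fun x => ?_)
    by_cases hx : x ∈ T <;> simp [hx]
  rw [h S hS, h Sᶜ hS.compl, fourierCoefficient, ← integral_add_compl hS hf]
  exact enorm_add_le _ _

theorem supNorm_ne_zero_of_norm_eq_one {g : Lp ℂ 2 (volume : Measure (Rn n))} (hg : ‖g‖ = 1) :
    supNorm g ≠ 0 := by
  intro h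
  have h0 : (g : Rn n → ℂ) =ᵐ[volume] 0 :=
    (eLpNorm_eq_zero_iff (Lp.memLp g).1 (by simp)).1 h
  have : g = 0 := Lp.eq_zero_iff_ae_eq_zero.2 h0
  simp [this] at hg

end Coefficients

/-! ### Elementary estimates for levels of coefficient ratios. -/

/-- Chebyshev at level t/2: it trades the weight of an index for the square of its coefficient,
ready for Bessel's inequality. -/
theorem sq_le_ofReal_mul_sq_of_half_mul_le {t : ℝ} (ht : 0 < t) {B G : ℝ≥0∞}
    (h : ENNReal.ofReal (t / 2) * B ≤ G) : B ^ 2 ≤ ENNReal.ofReal (4 * t ^ (-2 : ℝ)) * G ^ 2 := by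
  have h1 : (1 : ℝ≥0∞) = ENNReal.ofReal (4 * t ^ (-2 : ℝ)) * ENNReal.ofReal (t / 2) ^ 2 := by
    rw [← ENNReal.ofReal_pow (by positivity), ← ENNReal.ofReal_mul (by positivity),
      Real.rpow_neg ht.le, Real.rpow_two]
    have : 4 * (t ^ 2)⁻¹ * (t / 2) ^ 2 = 1 := by field_simp; norm_num
    rw [this, ENNReal.ofReal_one]
  calc B ^ 2 = ENNReal.ofReal (4 * t ^ (-2 : ℝ)) * (ENNReal.ofReal (t / 2) * B) ^ 2 := by
        rw [mul_pow, ← mul_assoc, ← h1, one_mul]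
    _ ≤ _ := by gcongr

/-- Rewrites a summand as weight times power of a ratio, the form the layer cake formula needs. -/
theorem ofReal_mul_rpow_div {B G : ℝ≥0∞} (hB0 : B ≠ 0) (hB : B ≠ ∞) (hG : G ≠ ∞) {q : ℝ}
    (hq : 0 ≤ q) :
    B ^ 2 * ENNReal.ofReal ((G.toReal / B.toReal) ^ q) = G ^ q * B ^ (2 - q) := by
  rw [← ENNReal.toReal_div, ENNReal.toReal_rpow, ENNReal.ofReal_toReal, ENNReal.div_rpow_of_nonneg _ _ hq,
    ENNReal.rpow_sub _ _ hB0 hB, ENNReal.rpow_two, ENNReal.div_eq_inv_mul, ENNReal.div_eq_inv_mul]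
  · ring
  · exact ENNReal.rpow_ne_top_of_nonneg hq (ENNReal.div_ne_top hG hB0)

theorem ofReal_mul_lt_of_lt_div {B G : ℝ≥0∞} (hB0 : B ≠ 0) (hB : B ≠ ∞) (hG : G ≠ ∞) {t : ℝ}
    (ht : 0 < t) (h : t < G.toReal / B.toReal) : ENNReal.ofReal t * B ≤ G := by
  have hBp : 0 < B.toReal := ENNReal.toReal_pos hB0 hB
  rw [lt_div_iff₀ hBp] at h
  rw [← ENNReal.ofReal_toReal hB, ← ENNReal.ofReal_toReal hG, ← ENNReal.ofReal_mul ht.le]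
  exact ENNReal.ofReal_le_ofReal h.le

theorem ofReal_eq_half_add_half {t : ℝ} (ht : 0 < t) :
    ENNReal.ofReal t = ENNReal.ofReal (t / 2) + ENNReal.ofReal (t / 2) := by
  rw [← ENNReal.ofReal_add (by positivity) (by positivity), add_halves]

theorem indicator_le_of_imp {ι : Type*} {s : Set ι} {h : ι → ℝ≥0∞} {a : ℝ≥0∞} {j : ι}
    (hj : j ∈ s → h j ≤ a) : s.indicator h j ≤ a := by
  by_cases hs : j ∈ s
  · rw [Set.indicator_of_mem hs]; exact hj hs
  · rw [Set.indicator_of_notMem hs]; exact zero_le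

/-! ### The Hausdorff-Young endpoint. -/

section Interpolation

variable {n : ℕ}

theorem lintegral_enorm_indicator_pow {X : Type*} [MeasurableSpace X] {μ : Measure X}
    {f : X → ℂ} {S : Set X} (hS : MeasurableSet S) {m : ℕ} (hm : m ≠ 0) :
    ∫⁻ x, ‖S.indicator f x‖ₑ ^ m ∂μ = ∫⁻ x in S, ‖f x‖ₑ ^ m ∂μ := by
  rw [← lintegral_indicator hS]
  refine lintegral_congr fun x => ?_
  by_cases hx : x ∈ S <;> simp [hx, hm]

/-- Hausdorff-Young bound at a fixed truncation parameter `c`. -/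
theorem tsum_hausdorffYoung_le_of_truncation {p q : ℝ} (hp1 : 1 < p) (hp2 : p < 2)
    (hq : q = p / (p - 1)) {u : ℕ → Lp ℂ 2 (volume : Measure (Rn n))} (hu : Orthonormal ℂ u)
    (hB : ∀ j, supNorm (u j) < ∞) {f : Rn n → ℂ} (hfm : Measurable f)
    (hf : MemLp f (ENNReal.ofReal p) volume) {c : ℝ} (hc : 0 < c)
    (hfc : 2 * ∫⁻ x, ‖f x‖ₑ ^ p ≤ ENNReal.ofReal c) :
    ∑' j, ‖fourierCoefficient (u j) f‖ₑ ^ q * supNorm (u j) ^ (2 - q) ≤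
      ENNReal.ofReal (4 * q / (q - 2) * c ^ (q - 2)) * ∫⁻ x, ‖f x‖ₑ ^ p := by
  have hpm : 0 < p - 1 := by linarith
  have hpq : (p - 1) * q = p := by rw [hq]; field_simp
  have hq2 : 2 < q := by rw [hq, lt_div_iff₀ hpm]; linarith
  have hB0 : ∀ j, supNorm (u j) ≠ 0 := fun j => supNorm_ne_zero_of_norm_eq_one (hu.1 j)
  have hint := fun j => integrable_mul_conj_of_supNorm_lt_top (hB j) hp1 hp2.le hf
  -- The section at t is where |f| is small; the cut height (c/t)^(1/(p-1)) is chosen so that the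
  -- large part has L¹ norm at most t/2.
  let E : Set (ℝ × Rn n) := {z | z.1 * ‖f z.2‖ ^ (p - 1) ≤ c}
  have hE : MeasurableSet E := measurableSet_le (by fun_prop) measurable_const
  have hEt : ∀ t, MeasurableSet {x | (t, x) ∈ E} := fun t => measurable_prodMk_left hE
  have hlevel : ∀ t : ℝ, 0 < t →
      ∑' j, {j | t < ‖fourierCoefficient (u j) f‖ₑ.toReal / (supNorm (u j)).toReal}.indicator
        (fun j => supNorm (u j) ^ 2) j ≤
      ENNReal.ofReal (4 * t ^ (-2 : ℝ)) * ∫⁻ x in {x | (t, x) ∈ E}, ‖f x‖ₑ ^ 2 := fun t ht => by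
    have h0 : ∫⁻ x, ‖{x | (t, x) ∈ E}ᶜ.indicator f x‖ₑ ≤ ENNReal.ofReal (t / 2) := by
      have : ∀ x, ‖{x | (t, x) ∈ E}ᶜ.indicator f x‖ₑ ≤ ENNReal.ofReal (t / c) * ‖f x‖ₑ ^ p := by
        intro x
        by_cases hx : (t, x) ∈ E
        · simp [hx]
        have hx' : c < t * ‖f x‖ ^ (p - 1) := not_le.1 hx
        rw [Set.indicator_of_mem (by simpa using hx), ← ofReal_norm,
          ENNReal.ofReal_rpow_of_nonneg (norm_nonneg _) (by linarith),
          ← ENNReal.ofReal_mul (by positivity)]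
        refine ENNReal.ofReal_le_ofReal ?_
        have hpow : ‖f x‖ ^ p = ‖f x‖ ^ (p - 1) * ‖f x‖ := by
          rw [← Real.rpow_add_one' (norm_nonneg _) (by linarith), sub_add_cancel]
        rw [hpow, ← mul_assoc]
        refine le_mul_of_one_le_left (norm_nonneg _) ?_
        rw [div_mul_eq_mul_div, one_le_div hc]
        exact hx'.le
      refine (lintegral_mono this).trans ?_
      rw [lintegral_const_mul _ (by fun_prop)]
      have h2 : ENNReal.ofReal (t / c) = ENNReal.ofReal (t / (2 * c)) * 2 := by
        rw [← ENNReal.ofReal_ofNat, ← ENNReal.ofReal_mul (by positivity)]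
        congr 1; field_simp
      rw [h2, mul_assoc]
      refine (mul_le_mul_right hfc _).trans_eq ?_
      rw [← ENNReal.ofReal_mul (by positivity)]
      congr 1; field_simp
    rw [← lintegral_enorm_indicator_pow (hEt t) two_ne_zero]
    refine le_trans ?_ (mul_le_mul_right (tsum_enorm_fourierCoefficient_sq_le hu
      (hfm.indicator (hEt t)).aestronglyMeasurable) _)
    rw [← ENNReal.tsum_mul_left]
    refine ENNReal.tsum_le_tsum fun j => indicator_le_of_imp fun hj => ?_
    refine sq_le_ofReal_mul_sq_of_half_mul_le ht ?_
    have h1 := ofReal_mul_lt_of_lt_div (hB0 j) (hB j).ne enorm_ne_top ht hj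
    have h3 := h1.trans (enorm_fourierCoefficient_le_indicator_add (hint j) (hEt t))
    have h4 := enorm_fourierCoefficient_le (u j) (hfm.indicator (hEt t).compl).aestronglyMeasurable
    have h5 := h3.trans (add_le_add_right (h4.trans (mul_le_mul_right h0 _)) _)
    -- The large part accounts for at most half of t B_j, so the small part accounts for the other
    -- half.
    rw [ofReal_eq_half_add_half ht, add_mul, mul_comm (supNorm (u j))] at h5
    exact (ENNReal.add_le_add_iff_right (ENNReal.mul_ne_top (by simp) (hB j).ne)).1 h5
  calc ∑' j, ‖fourierCoefficient (u j) f‖ₑ ^ q * supNorm (u j) ^ (2 - q)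
      = ∑' j, supNorm (u j) ^ 2 * ENNReal.ofReal
          ((‖fourierCoefficient (u j) f‖ₑ.toReal / (supNorm (u j)).toReal) ^ q) := by
        refine tsum_congr fun j => ?_
        rw [ofReal_mul_rpow_div (hB0 j) (hB j).ne enorm_ne_top (by linarith)]
    _ = ENNReal.ofReal q * ∫⁻ t in Set.Ioi (0 : ℝ),
          (∑' j, {j | t < ‖fourierCoefficient (u j) f‖ₑ.toReal / (supNorm (u j)).toReal}.indicator
            (fun j => supNorm (u j) ^ 2) j) * ENNReal.ofReal (t ^ (q - 1)) :=
        tsum_mul_ofReal_rpow_eq_lintegral _ _ (fun j => by positivity) (by linarith)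
    _ ≤ ENNReal.ofReal q * ∫⁻ t in Set.Ioi (0 : ℝ),
          (∫⁻ x in {x | (t, x) ∈ E}, ‖f x‖ₑ ^ 2) * ENNReal.ofReal (4 * t ^ (q - 3)) := by
        gcongr ENNReal.ofReal q * ?_
        refine setLIntegral_mono' measurableSet_Ioi fun t ht => ?_
        have ht' : 0 < t := ht
        refine (mul_le_mul_left (hlevel t ht) _).trans_eq ?_
        rw [mul_comm, ← mul_assoc, ← ENNReal.ofReal_mul (by positivity), mul_comm]
        congr 2
        rw [mul_left_comm, ← Real.rpow_add ht']
        ring_nf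
    _ = ENNReal.ofReal q * ∫⁻ x, ‖f x‖ₑ ^ 2 *
          ∫⁻ t in {t | 0 < t ∧ (t, x) ∈ E}, ENNReal.ofReal (4 * t ^ (q - 3)) := by
        rw [lintegral_setLIntegral_mul_swap hE (by fun_prop) (by fun_prop)]
    _ ≤ ENNReal.ofReal q * ∫⁻ x, ENNReal.ofReal (4 / (q - 2) * c ^ (q - 2)) * ‖f x‖ₑ ^ p := by
        gcongr ENNReal.ofReal q * (lintegral _ fun x => ?_)
        rcases eq_or_ne (f x) 0 with h0 | h0
        · simp [h0]
        have hfx : 0 < ‖f x‖ := norm_pos_iff.2 h0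
        have hset : {t | 0 < t ∧ (t, x) ∈ E} = Set.Ioc 0 (c / ‖f x‖ ^ (p - 1)) := by
          ext t
          simp [E, le_div_iff₀ (Real.rpow_pos_of_pos hfx (p - 1))]
        simp_rw [ENNReal.ofReal_mul (zero_le_four (α := ℝ))]
        rw [hset, lintegral_const_mul _ (by fun_prop), lintegral_Ioc_rpow (by linarith) (by positivity),
          ← ENNReal.ofReal_mul (by positivity), ← ofReal_norm, ← ENNReal.ofReal_pow (norm_nonneg _),
          ← ENNReal.ofReal_mul (by positivity),
          ENNReal.ofReal_rpow_of_nonneg (norm_nonneg _) (by linarith),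
          ← ENNReal.ofReal_mul (by have := Real.rpow_nonneg hc.le (q - 2); have : 0 < q - 2 := by linarith
                                   positivity)]
        refine ENNReal.ofReal_le_ofReal (le_of_eq ?_)
        have e1 : q - 3 + 1 = q - 2 := by ring
        -- Exponents match because (p-1)(q-2) = 2-p.
        have e2 : ‖f x‖ ^ p * (‖f x‖ ^ (p - 1)) ^ (q - 2) = ‖f x‖ ^ 2 := by
          rw [← Real.rpow_mul hfx.le, ← Real.rpow_add hfx, ← Real.rpow_two]
          congr 1; linarith
        rw [e1, Real.div_rpow hc.le (by positivity), ← e2]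
        have : q - 2 ≠ 0 := by linarith
        field_simp
    _ = _ := by
        rw [lintegral_const_mul _ (by fun_prop), ← mul_assoc, ← ENNReal.ofReal_mul (by linarith)]
        congr 2; ring

/-- The Hausdorff-Young inequality for the coefficients with respect to a bounded orthonormal
system, with weights given by the sup norms. -/
theorem tsum_hausdorffYoung_le {p q : ℝ} (hp1 : 1 < p) (hp2 : p < 2)
    (hq : q = p / (p - 1)) {u : ℕ → Lp ℂ 2 (volume : Measure (Rn n))} (hu : Orthonormal ℂ u)
    (hB : ∀ j, supNorm (u j) < ∞) {f : Rn n → ℂ} (hfm : Measurable f)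
    (hf : MemLp f (ENNReal.ofReal p) volume) :
    ∑' j, ‖fourierCoefficient (u j) f‖ₑ ^ q * supNorm (u j) ^ (2 - q) ≤
      ENNReal.ofReal (4 * q / (q - 2) * 2 ^ (q - 2)) * (∫⁻ x, ‖f x‖ₑ ^ p) ^ (q - 1) := by
  have hq2 : 2 < q := by rw [hq, lt_div_iff₀ (by linarith)]; linarith
  have hN : ∫⁻ x, ‖f x‖ₑ ^ p ≠ ∞ := by
    have := lintegral_rpow_enorm_lt_top_of_eLpNorm_lt_top (by simp; linarith) (by simp) hf.2
    rw [ENNReal.toReal_ofReal (by linarith)] at this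
    exact this.ne
  have key := fun c : ℝ => tsum_hausdorffYoung_le_of_truncation hp1 hp2 hq hu hB hfm hf (c := c)
  generalize ∫⁻ x, ‖f x‖ₑ ^ p = N at hN key ⊢
  rcases eq_or_ne N 0 with h0 | h0
  · exact (key 1 one_pos (by simp [h0])).trans (by simp [h0])
  have hNp : 0 < N.toReal := ENNReal.toReal_pos h0 hN
  -- The least admissible c is 2N; then c^(q-2) N produces N^(q-1).
  refine (key (2 * N.toReal) (by positivity) ?_).trans_eq ?_
  · rw [ENNReal.ofReal_mul zero_le_two, ENNReal.ofReal_toReal hN, ENNReal.ofReal_ofNat]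
  · have hK : 0 ≤ 4 * q / (q - 2) * 2 ^ (q - 2) := by
      have : 0 < q - 2 := by linarith
      positivity
    have e : q - 1 = (q - 2) + 1 := by ring
    rw [Real.mul_rpow zero_le_two hNp.le, ← mul_assoc, ENNReal.ofReal_mul hK,
      ← ENNReal.ofReal_rpow_of_pos hNp, ENNReal.ofReal_toReal hN, e,
      ENNReal.rpow_add _ _ h0 hN, ENNReal.rpow_one, mul_assoc]

/-! ### The Paley endpoint. -/

/-- The weak type bound hidden in the finiteness of the Paley constant. -/
theorem tsum_indicator_le_paleyConstant_mul {u : ℕ → Lp ℂ 2 (volume : Measure (Rn n))}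
    {φ : ℕ → ℝ} (hφ : ∀ j, 0 < φ j) (hM : paleyConstant u φ ≠ 0) (v : ℝ≥0∞) :
    ∑' j, {j | ENNReal.ofReal (φ j) ≤ v}.indicator
      (fun j => (ENNReal.ofReal (φ j) * supNorm (u j)) ^ 2) j ≤ 2 * paleyConstant u φ * v := by
  rcases eq_or_ne v ∞ with rfl | hv
  · simp [ENNReal.mul_top, hM]
  lift v to ℝ≥0 using hv
  -- Layer cake applied to φ_j^2, whence the factor 2. For t ≤ v the integrand is at most M by
  -- definition of the supremum; for t > v the level set is empty.
  have h := tsum_mul_ofReal_rpow_eq_lintegral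
    ({j | ENNReal.ofReal (φ j) ≤ v}.indicator fun j => supNorm (u j) ^ 2) φ (fun j => (hφ j).le)
    (q := 2) zero_lt_two
  have e : ∀ j, {j | ENNReal.ofReal (φ j) ≤ v}.indicator
      (fun j => (ENNReal.ofReal (φ j) * supNorm (u j)) ^ 2) j =
      {j | ENNReal.ofReal (φ j) ≤ v}.indicator (fun j => supNorm (u j) ^ 2) j *
        ENNReal.ofReal (φ j ^ (2 : ℝ)) := fun j => by
    by_cases hj : j ∈ {j | ENNReal.ofReal (φ j) ≤ v}
    · rw [Set.indicator_of_mem hj, Set.indicator_of_mem hj, mul_pow, mul_comm, Real.rpow_two,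
        ENNReal.ofReal_pow (hφ j).le]
    · rw [Set.indicator_of_notMem hj, Set.indicator_of_notMem hj, zero_mul]
  rw [tsum_congr e, h, mul_assoc, ENNReal.ofReal_ofNat]
  gcongr 2 * ?_
  calc _ ≤ ∫⁻ t in Set.Ioi (0 : ℝ), (Set.Ioc 0 (v : ℝ)).indicator
        (fun _ => paleyConstant u φ) t := by
        refine setLIntegral_mono' measurableSet_Ioi fun t ht => ?_
        by_cases htv : t ≤ v
        · rw [Set.indicator_of_mem (show t ∈ Set.Ioc 0 (v : ℝ) from ⟨ht, htv⟩)]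
          refine le_trans ?_ (le_iSup₂ (f := fun (t : ℝ) (_ : 0 < t) =>
            ENNReal.ofReal t * ∑' j : {j : ℕ // t ≤ φ j}, supNorm (u j) ^ 2) t ht)
          have e : ∑' j : {j : ℕ // t ≤ φ j}, supNorm (u j) ^ 2 = _ :=
            tsum_subtype {j | t ≤ φ j} (fun j => supNorm (u j) ^ 2)
          rw [e, mul_comm, show (2 : ℝ) - 1 = 1 by norm_num, Real.rpow_one]
          refine mul_le_mul_right (ENNReal.tsum_le_tsum fun j => indicator_le_of_imp fun hj => ?_) _
          rw [Set.indicator_of_mem (show j ∈ {j | t ≤ φ j} from Set.mem_ofPred.2 (le_of_lt hj))]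
          exact Set.indicator_le_self _ _ _
        · have : ∀ j, {j | t < φ j}.indicator ({j | ENNReal.ofReal (φ j) ≤ v}.indicator
              fun j => supNorm (u j) ^ 2) j = 0 := fun j => by
            refine Set.indicator_apply_eq_zero.2 fun hj => Set.indicator_of_notMem (fun hj' => ?_) _
            have : φ j ≤ v := by simpa [ENNReal.ofReal_le_iff_le_toReal] using hj'
            exact htv ((le_of_lt hj).trans this)
          rw [tsum_congr this, tsum_zero, zero_mul]
          exact zero_le
    _ = paleyConstant u φ * v := by
        rw [lintegral_indicator measurableSet_Ioc, setLIntegral_const,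
          Measure.restrict_apply measurableSet_Ioc,
          Set.inter_eq_left.2 Set.Ioc_subset_Ioi_self, Real.volume_Ioc]
        simp

/-- Paley's inequality for the coefficients with respect to a bounded orthonormal system. -/
theorem tsum_paley_le {p : ℝ} (hp1 : 1 < p) (hp2 : p < 2)
    {u : ℕ → Lp ℂ 2 (volume : Measure (Rn n))} (hu : Orthonormal ℂ u)
    (hB : ∀ j, supNorm (u j) < ∞) {φ : ℕ → ℝ} (hφ : ∀ j, 0 < φ j)
    (hM0 : paleyConstant u φ ≠ 0) (hM : paleyConstant u φ ≠ ∞)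
    {f : Rn n → ℂ} (hfm : Measurable f) (hf : MemLp f (ENNReal.ofReal p) volume) :
    ∑' j, ‖fourierCoefficient (u j) f‖ₑ ^ p *
        (ENNReal.ofReal (φ j) * supNorm (u j)) ^ (2 - p) ≤
      ENNReal.ofReal (4 * p * (1 / (p - 1) + 1 / (2 - p))) * paleyConstant u φ ^ (2 - p) *
        ∫⁻ x, ‖f x‖ₑ ^ p := by
  have hpm : 0 < p - 1 := by linarith
  have hpm2 : 0 < 2 - p := by linarith
  have hB0 : ∀ j, supNorm (u j) ≠ 0 := fun j => supNorm_ne_zero_of_norm_eq_one (hu.1 j)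
  have hint := fun j => integrable_mul_conj_of_supNorm_lt_top (hB j) hp1 hp2.le hf
  set W : ℕ → ℝ≥0∞ := fun j => ENNReal.ofReal (φ j) * supNorm (u j)
  have hW0 : ∀ j, W j ≠ 0 := fun j => mul_ne_zero (by simpa using hφ j) (hB0 j)
  have hWt : ∀ j, W j ≠ ∞ := fun j => ENNReal.mul_ne_top (by simp) (hB j).ne
  have hweak := tsum_indicator_le_paleyConstant_mul hφ hM0
  obtain ⟨m, hm, hMm⟩ : ∃ m : ℝ, 0 < m ∧ paleyConstant u φ = ENNReal.ofReal m :=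
    ⟨_, ENNReal.toReal_pos hM0 hM, (ENNReal.ofReal_toReal hM).symm⟩
  rw [hMm] at hweak ⊢
  -- Cutting at height m t makes both the large and the small part contribute the same power
  -- m^(2-p).
  let E : Set (ℝ × Rn n) := {z | ‖f z.2‖ ≤ m * z.1}
  have hE : MeasurableSet E := measurableSet_le (by fun_prop) (by fun_prop)
  have hEt : ∀ t, MeasurableSet {x | (t, x) ∈ E} := fun t => measurable_prodMk_left hE
  have hlevel : ∀ t : ℝ, 0 < t →
      ∑' j, {j | t < ‖fourierCoefficient (u j) f‖ₑ.toReal / (W j).toReal}.indicator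
        (fun j => W j ^ 2) j ≤
      ENNReal.ofReal (4 * m * t ^ (-1 : ℝ)) * (∫⁻ x in {x | (t, x) ∈ Eᶜ}, ‖f x‖ₑ) +
      ENNReal.ofReal (4 * t ^ (-2 : ℝ)) * ∫⁻ x in {x | (t, x) ∈ E}, ‖f x‖ₑ ^ 2 := fun t ht => by
    -- Threshold for φ_j: if φ_j > v, the large part contributes at most (t/2) φ_j B_j and the small
    -- part must supply the rest; the indices with φ_j ≤ v have total weight at most 2 m v.
    set v := ENNReal.ofReal (2 * t ^ (-1 : ℝ)) * ∫⁻ x in {x | (t, x) ∈ Eᶜ}, ‖f x‖ₑ with hv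
    have h1 : ENNReal.ofReal (4 * m * t ^ (-1 : ℝ)) * (∫⁻ x in {x | (t, x) ∈ Eᶜ}, ‖f x‖ₑ) =
        2 * ENNReal.ofReal m * v := by
      have h2 : (2 : ℝ≥0∞) * ENNReal.ofReal m * ENNReal.ofReal (2 * t ^ (-1 : ℝ)) =
          ENNReal.ofReal (4 * m * t ^ (-1 : ℝ)) := by
        rw [← ENNReal.ofReal_ofNat, ← ENNReal.ofReal_mul (by simp),
          ← ENNReal.ofReal_mul (by positivity)]
        congr 1; ring
      rw [hv, ← mul_assoc, h2]
    rw [h1]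
    refine le_trans ?_ (add_le_add (hweak v) (mul_le_mul_right
      ((tsum_enorm_fourierCoefficient_sq_le hu
        (hfm.indicator (hEt t)).aestronglyMeasurable).trans_eq
          (lintegral_enorm_indicator_pow (hEt t) two_ne_zero)) _))
    rw [← ENNReal.tsum_mul_left, ← ENNReal.tsum_add]
    refine ENNReal.tsum_le_tsum fun j => indicator_le_of_imp fun hj => ?_
    by_cases hjv : ENNReal.ofReal (φ j) ≤ v
    · rw [Set.indicator_of_mem (show j ∈ {j | ENNReal.ofReal (φ j) ≤ v} from hjv)]
      exact le_self_add
    refine le_trans (sq_le_ofReal_mul_sq_of_half_mul_le ht ?_) le_add_self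
    have h2 := ofReal_mul_lt_of_lt_div (hW0 j) (hWt j) enorm_ne_top ht hj
    have h3 := h2.trans (enorm_fourierCoefficient_le_indicator_add (hint j) (hEt t))
    have h4 := enorm_fourierCoefficient_le (u j) (hfm.indicator (hEt t).compl).aestronglyMeasurable
    have h5 : ∫⁻ x, ‖{x | (t, x) ∈ E}ᶜ.indicator f x‖ₑ = ENNReal.ofReal (t / 2) * v := by
      have := lintegral_enorm_indicator_pow (μ := volume) (f := f) (hEt t).compl one_ne_zero
      simp only [pow_one] at this
      rw [this, hv, ← mul_assoc, ← ENNReal.ofReal_mul (by positivity), Real.rpow_neg_one]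
      have : t / 2 * (2 * t⁻¹) = 1 := by field_simp
      rw [this, ENNReal.ofReal_one, one_mul]
      rfl
    have h6 : supNorm (u j) * (∫⁻ x, ‖{x | (t, x) ∈ E}ᶜ.indicator f x‖ₑ) ≤
        ENNReal.ofReal (t / 2) * W j := by
      rw [h5, mul_left_comm, mul_comm (supNorm (u j))]
      exact mul_le_mul_right (mul_le_mul_left (not_le.1 hjv).le _) _
    have h7 := h3.trans (add_le_add_right (h4.trans h6) _)
    rw [ofReal_eq_half_add_half ht, add_mul] at h7
    exact (ENNReal.add_le_add_iff_right (ENNReal.mul_ne_top (by simp) (hWt j))).1 h7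
  have hlarge : ∫⁻ t in Set.Ioi (0 : ℝ), (∫⁻ x in {x | (t, x) ∈ Eᶜ}, ‖f x‖ₑ) *
      ENNReal.ofReal (4 * m * t ^ (p - 2)) ≤
      ENNReal.ofReal (4 / (p - 1) * m ^ (2 - p)) * ∫⁻ x, ‖f x‖ₑ ^ p := by
    rw [lintegral_setLIntegral_mul_swap hE.compl (by fun_prop) (by fun_prop),
      ← lintegral_const_mul _ (by fun_prop)]
    refine lintegral_mono fun x => ?_
    rcases eq_or_ne (f x) 0 with h0 | h0
    · simp [h0]
    have hfx : 0 < ‖f x‖ := norm_pos_iff.2 h0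
    have hset : {t | 0 < t ∧ (t, x) ∈ Eᶜ} ⊆ Set.Ioc 0 (‖f x‖ / m) := by
      rintro t ⟨ht, htE⟩
      have : m * t < ‖f x‖ := not_le.1 htE
      exact ⟨ht, by rw [le_div_iff₀ hm]; linarith⟩
    refine (mul_le_mul_right (lintegral_mono_set hset) _).trans ?_
    simp_rw [ENNReal.ofReal_mul (show 0 ≤ 4 * m by positivity)]
    rw [lintegral_const_mul _ (by fun_prop), lintegral_Ioc_rpow (by linarith) (by positivity),
      ← ENNReal.ofReal_mul (by positivity), ← ofReal_norm, ← ENNReal.ofReal_mul (by positivity),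
      ENNReal.ofReal_rpow_of_nonneg (norm_nonneg _) (by linarith),
      ← ENNReal.ofReal_mul (by positivity)]
    refine ENNReal.ofReal_le_ofReal (le_of_eq ?_)
    have e1 : p - 2 + 1 = p - 1 := by ring
    have e2 : ‖f x‖ ^ p = ‖f x‖ ^ (p - 1) * ‖f x‖ := by
      rw [← Real.rpow_add_one hfx.ne', sub_add_cancel]
    have e3 : m ^ (2 - p) * m ^ (p - 1) = m := by
      rw [← Real.rpow_add hm]; ring_nf; exact Real.rpow_one m
    rw [e1, Real.div_rpow hfx.le hm.le, e2]
    nth_rewrite 1 [← e3]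
    field_simp
  have hsmall : ∫⁻ t in Set.Ioi (0 : ℝ), (∫⁻ x in {x | (t, x) ∈ E}, ‖f x‖ₑ ^ 2) *
      ENNReal.ofReal (4 * t ^ (p - 3)) ≤
      ENNReal.ofReal (4 / (2 - p) * m ^ (2 - p)) * ∫⁻ x, ‖f x‖ₑ ^ p := by
    rw [lintegral_setLIntegral_mul_swap hE (by fun_prop) (by fun_prop),
      ← lintegral_const_mul _ (by fun_prop)]
    refine lintegral_mono fun x => ?_
    rcases eq_or_ne (f x) 0 with h0 | h0
    · simp [h0]
    have hfx : 0 < ‖f x‖ := norm_pos_iff.2 h0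
    have hset : {t | 0 < t ∧ (t, x) ∈ E} ⊆ Set.Ici (‖f x‖ / m) := by
      rintro t ⟨ht, htE⟩
      have : ‖f x‖ ≤ m * t := htE
      rw [Set.mem_Ici, div_le_iff₀ hm]
      linarith
    refine (mul_le_mul_right (lintegral_mono_set hset) _).trans ?_
    simp_rw [ENNReal.ofReal_mul (zero_le_four (α := ℝ))]
    rw [lintegral_const_mul _ (by fun_prop), setLIntegral_congr Ioi_ae_eq_Ici.symm,
      lintegral_Ioi_rpow (by linarith) (by positivity),
      ← ENNReal.ofReal_mul (by positivity), ← ofReal_norm, ← ENNReal.ofReal_pow (norm_nonneg _),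
      ← ENNReal.ofReal_mul (by positivity),
      ENNReal.ofReal_rpow_of_nonneg (norm_nonneg _) (by linarith),
      ← ENNReal.ofReal_mul (by positivity)]
    refine ENNReal.ofReal_le_ofReal (le_of_eq ?_)
    have e1 : p - 3 + 1 = -(2 - p) := by ring
    have e2 : ‖f x‖ ^ p * ‖f x‖ ^ (2 - p) = ‖f x‖ ^ 2 := by
      rw [← Real.rpow_add hfx, ← Real.rpow_two]; ring_nf
    rw [e1, Real.rpow_neg (by positivity), Real.div_rpow hfx.le hm.le, ← e2]
    field_simp
  calc ∑' j, ‖fourierCoefficient (u j) f‖ₑ ^ p * W j ^ (2 - p)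
      = ∑' j, W j ^ 2 * ENNReal.ofReal
          ((‖fourierCoefficient (u j) f‖ₑ.toReal / (W j).toReal) ^ p) := by
        refine tsum_congr fun j => ?_
        rw [ofReal_mul_rpow_div (hW0 j) (hWt j) enorm_ne_top (by linarith)]
    _ = ENNReal.ofReal p * ∫⁻ t in Set.Ioi (0 : ℝ),
          (∑' j, {j | t < ‖fourierCoefficient (u j) f‖ₑ.toReal / (W j).toReal}.indicator
            (fun j => W j ^ 2) j) * ENNReal.ofReal (t ^ (p - 1)) :=
        tsum_mul_ofReal_rpow_eq_lintegral _ _ (fun j => by positivity) (by linarith)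
    _ ≤ ENNReal.ofReal p * ∫⁻ t in Set.Ioi (0 : ℝ),
          ((∫⁻ x in {x | (t, x) ∈ Eᶜ}, ‖f x‖ₑ) * ENNReal.ofReal (4 * m * t ^ (p - 2)) +
          (∫⁻ x in {x | (t, x) ∈ E}, ‖f x‖ₑ ^ 2) * ENNReal.ofReal (4 * t ^ (p - 3))) := by
        gcongr ENNReal.ofReal p * ?_
        refine setLIntegral_mono' measurableSet_Ioi fun t ht => ?_
        have ht' : 0 < t := ht
        refine (mul_le_mul_left (hlevel t ht) _).trans_eq ?_
        have e1 : t ^ (p - 2) = t ^ (-1 : ℝ) * t ^ (p - 1) := by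
          rw [← Real.rpow_add ht']; ring_nf
        have e2 : t ^ (p - 3) = t ^ (-2 : ℝ) * t ^ (p - 1) := by
          rw [← Real.rpow_add ht']; ring_nf
        rw [e1, e2, ← mul_assoc, ← mul_assoc, ENNReal.ofReal_mul (p := 4 * m * _) (by positivity),
          ENNReal.ofReal_mul (p := 4 * t ^ (-2 : ℝ)) (by positivity)]
        ring
    _ ≤ ENNReal.ofReal p * (ENNReal.ofReal (4 / (p - 1) * m ^ (2 - p)) * (∫⁻ x, ‖f x‖ₑ ^ p) +
          ENNReal.ofReal (4 / (2 - p) * m ^ (2 - p)) * ∫⁻ x, ‖f x‖ₑ ^ p) := by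
        gcongr ENNReal.ofReal p * ?_
        rw [lintegral_add_left]
        · exact add_le_add hlarge hsmall
        -- Splitting the integral needs measurability in t of the truncated integral, which follows
        -- from joint measurability.
        refine Measurable.mul ?_ (by fun_prop)
        have : Measurable fun z : ℝ × Rn n => Eᶜ.indicator (fun z => ‖f z.2‖ₑ) z :=
          Measurable.indicator (by fun_prop) hE.compl
        have e : (fun t => ∫⁻ x in {x | (t, x) ∈ Eᶜ}, ‖f x‖ₑ) =
            fun t => ∫⁻ x, Eᶜ.indicator (fun z => ‖f z.2‖ₑ) (t, x) := by
          funext t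
          rw [← lintegral_indicator (s := {x | (t, x) ∈ Eᶜ}) (measurable_prodMk_left hE.compl)]
          rfl
        rw [e]
        exact this.lintegral_prod_right' (ν := volume)
    _ = _ := by
        rw [← add_mul, ← ENNReal.ofReal_add (by positivity) (by positivity), ← mul_assoc,
          ← ENNReal.ofReal_mul (by positivity), ENNReal.ofReal_rpow_of_pos hm,
          ← ENNReal.ofReal_mul (by positivity)]
        congr 2; ring

end Interpolation

/-! ### Consequences of a finite Paley constant, and Hölder interpolation. -/

section PaleyInterpolation

variable {n : ℕ}

/-- At t = φ_j the index j itself occurs in the sum. -/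
theorem supNorm_lt_top_of_paleyConstant_lt_top {u : ℕ → Lp ℂ 2 (volume : Measure (Rn n))}
    {φ : ℕ → ℝ} (hφ : ∀ j, 0 < φ j) (hM : paleyConstant u φ < ∞) (j : ℕ) :
    supNorm (u j) < ∞ := by
  have h1 := (le_iSup₂ (f := fun (t : ℝ) (_ : 0 < t) =>
    ENNReal.ofReal t * ∑' j : {j : ℕ // t ≤ φ j}, supNorm (u j) ^ 2) (φ j) (hφ j)).trans_lt hM
  have h2 : ∑' i : {i : ℕ // φ j ≤ φ i}, supNorm (u i) ^ 2 < ∞ :=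
    ENNReal.lt_top_of_mul_ne_top_right h1.ne (by simpa using hφ j)
  have h3 := (ENNReal.le_tsum (f := fun i : {i : ℕ // φ j ≤ φ i} => supNorm (u i) ^ 2)
    ⟨j, le_rfl⟩).trans_lt h2
  simpa using h3

theorem paleyConstant_ne_zero {u : ℕ → Lp ℂ 2 (volume : Measure (Rn n))} (hu : Orthonormal ℂ u)
    {φ : ℕ → ℝ} (hφ : ∀ j, 0 < φ j) : paleyConstant u φ ≠ 0 := by
  intro h
  have h1 := (le_iSup₂ (f := fun (t : ℝ) (_ : 0 < t) =>
    ENNReal.ofReal t * ∑' j : {j : ℕ // t ≤ φ j}, supNorm (u j) ^ 2) (φ 0) (hφ 0)).trans_eq h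
  have h2 : ∑' i : {i : ℕ // φ 0 ≤ φ i}, supNorm (u i) ^ 2 = 0 :=
    (mul_eq_zero.1 (le_antisymm h1 zero_le)).resolve_left (by simpa using hφ 0)
  have h3 := ENNReal.tsum_eq_zero.1 h2 ⟨0, le_rfl⟩
  exact supNorm_ne_zero_of_norm_eq_one (hu.1 0) (by simpa using h3)

/-- Interpolation between the Paley and the Hausdorff-Young sums by Hölder's inequality. -/
theorem tsum_paley_interpolation_le {p q b : ℝ} (hp1 : 1 < p) (hp2 : p < 2)
    (hq : q = p / (p - 1)) (hpb : p ≤ b) (hbq : b ≤ q) {G B φ : ℕ → ℝ≥0∞}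
    (hφt : ∀ j, φ j ≠ ∞) (hB0 : ∀ j, B j ≠ 0) (hBt : ∀ j, B j ≠ ∞)
    {C M N : ℝ≥0∞} (hC : 1 ≤ C)
    (hpaley : ∑' j, G j ^ p * (φ j * B j) ^ (2 - p) ≤ C * M ^ (2 - p) * N)
    (hyoung : ∑' j, G j ^ q * B j ^ (2 - q) ≤ C * N ^ (q - 1)) :
    (∑' j, (G j * φ j ^ (1 / b - 1 / q)) ^ b * B j ^ (2 - b)) ^ (1 / b) ≤
      C * M ^ (1 / b - 1 / q) * N ^ (1 / p) := by
  have hpm : 0 < p - 1 := by linarith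
  have hq2 : 2 < q := by rw [hq, lt_div_iff₀ hpm]; linarith
  have hb : 0 < b := by linarith
  have hqp : 0 < q - p := by linarith
  have hpq : p * q = p + q := by rw [hq]; field_simp; ring
  -- Barycentric weights of b between p and q. The exponent of φ comes out right because pq = p + q
  -- gives (2-p)/(q-p) = 1/q.
  set α := (q - b) / (q - p) with hα
  set β := (b - p) / (q - p) with hβ
  have hα0 : 0 ≤ α := div_nonneg (by linarith) hqp.le
  have hβ0 : 0 ≤ β := div_nonneg (by linarith) hqp.le
  have hαβ : α + β = 1 := by rw [hα, hβ]; field_simp; ring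
  have e1 : p * α + q * β = b := by rw [hα, hβ]; field_simp; ring
  have e2 : (2 - p) * α = (1 / b - 1 / q) * b := by
    rw [hα]; field_simp
    nlinarith
  have e3 : (2 - p) * α + (2 - q) * β = 2 - b := by
    linear_combination 2 * hαβ - e1
  have e4 : α + (q - 1) * β = b / p := by
    rw [hα, hβ]; field_simp
    linear_combination (b - p) * hpq
  have hterm : ∀ j, (G j * φ j ^ (1 / b - 1 / q)) ^ b * B j ^ (2 - b) =
      (G j ^ p * (φ j * B j) ^ (2 - p)) ^ α * (G j ^ q * B j ^ (2 - q)) ^ β := fun j => by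
    rw [ENNReal.mul_rpow_of_nonneg _ _ hb.le, ENNReal.mul_rpow_of_nonneg _ _ hα0,
      ENNReal.mul_rpow_of_nonneg _ _ hβ0, ENNReal.mul_rpow_of_ne_top (hφt j) (hBt j),
      ENNReal.mul_rpow_of_nonneg _ _ hα0]
    simp only [← ENNReal.rpow_mul]
    rw [← e2, ← e3, ← e1, ENNReal.rpow_add_of_nonneg (x := G j) _ _ (by positivity) (by positivity),
      ENNReal.rpow_add _ _ (hB0 j) (hBt j)]
    ring
  have hholder := ENNReal.lintegral_mul_norm_pow_le (μ := (Measure.count : Measure ℕ))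
    (f := fun j => G j ^ p * (φ j * B j) ^ (2 - p)) (g := fun j => G j ^ q * B j ^ (2 - q))
    (by fun_prop) (by fun_prop) hα0 hβ0 hαβ
  simp only [lintegral_count] at hholder
  rw [tsum_congr hterm]
  calc _ ≤ ((C * M ^ (2 - p) * N) ^ α * (C * N ^ (q - 1)) ^ β) ^ (1 / b) := by
        gcongr
        exact hholder.trans (by gcongr)
    _ = C ^ (1 / b) * M ^ (1 / b - 1 / q) * N ^ (1 / p) := by
        have hq1 : 0 ≤ q - 1 := by linarith
        rw [ENNReal.mul_rpow_of_nonneg _ _ hα0, ENNReal.mul_rpow_of_nonneg _ _ hα0,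
          ENNReal.mul_rpow_of_nonneg _ _ hβ0]
        have : C ^ α * (M ^ (2 - p)) ^ α * N ^ α * (C ^ β * (N ^ (q - 1)) ^ β) =
            C ^ (α + β) * M ^ ((2 - p) * α) * N ^ (α + (q - 1) * β) := by
          rw [ENNReal.rpow_add_of_nonneg _ _ hα0 hβ0,
            ENNReal.rpow_add_of_nonneg (x := N) _ _ hα0 (by positivity),
            ENNReal.rpow_mul, ENNReal.rpow_mul]
          ring
        rw [this, hαβ, e2, e4, ENNReal.rpow_one, ENNReal.mul_rpow_of_nonneg _ _ (by positivity),
          ENNReal.mul_rpow_of_nonneg _ _ (by positivity), ← ENNReal.rpow_mul, ← ENNReal.rpow_mul,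
          mul_assoc _ b, mul_one_div_cancel hb.ne', mul_one,
          show b / p * (1 / b) = 1 / p by field_simp]
    -- As b > 1 and C ≥ 1, C^(1/b) ≤ C removes the dependence on b.
    _ ≤ _ := by
        gcongr
        calc C ^ (1 / b) ≤ C ^ (1 : ℝ) := by
              refine ENNReal.rpow_le_rpow_of_exponent_le hC ?_
              rw [div_le_one hb]; linarith
          _ = C := ENNReal.rpow_one C

end PaleyInterpolation

/-! ### Assembly of the endpoints. -/

theorem theorem4p3 (p : ℝ) (hp1 : 1 < p) (hp2 : p ≤ 2) :
    ∃ C : ℝ≥0, ∀ n k l : ℕ, 1 ≤ n → 1 ≤ k → 1 ≤ l →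
      ∀ u : HilbertBasis ℕ ℂ (Lp ℂ 2 (volume : Measure (Rn n))), IsEigenbasis n k l u →
      ∀ p' b : ℝ, p' = p / (p - 1) → p ≤ b → b ≤ p' →
      ∀ φ : ℕ → ℝ, (∀ j, 0 < φ j) → paleyConstant (fun j => u j) φ < ∞ →
      ∀ f : Rn n → ℂ, MemLp f (ENNReal.ofReal p) volume →
        (∀ j, Integrable (fun x => f x * (starRingEnd ℂ) (u j x)) volume) ∧
        (∑' j, (‖fourierCoefficient (u j) f‖ₑ * ENNReal.ofReal (φ j) ^ (1 / b - 1 / p')) ^ b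
            * supNorm (u j) ^ (2 - b)) ^ (1 / b)
          ≤ C * paleyConstant (fun j => u j) φ ^ (1 / b - 1 / p')
              * eLpNorm f (ENNReal.ofReal p) volume := by
  set q := p / (p - 1) with hq
  -- Maximum of 1 and the two endpoint constants. At p = 2 the divisions by zero take the value 0,
  -- harmlessly: only 1 ≤ C is needed there.
  refine ⟨(1 ⊔ 4 * p * (1 / (p - 1) + 1 / (2 - p)) ⊔ 4 * q / (q - 2) * 2 ^ (q - 2)).toNNReal, ?_⟩
  rintro n k l - - - u - _ b rfl hpb hbq φ hφ hM f hf
  have hu : Orthonormal ℂ fun j => u j := u.orthonormal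
  have hB := supNorm_lt_top_of_paleyConstant_lt_top hφ hM
  refine ⟨fun j => integrable_mul_conj_of_supNorm_lt_top (hB j) hp1 hp2 hf, ?_⟩
  change _ ≤ ENNReal.ofReal _ * _ * _
  have hnorm : eLpNorm f (ENNReal.ofReal p) volume = (∫⁻ x, ‖f x‖ₑ ^ p) ^ (1 / p) := by
    rw [eLpNorm_eq_lintegral_rpow_enorm_toReal (by simp; linarith) (by simp),
      ENNReal.toReal_ofReal (by linarith)]
  rw [hnorm]
  rcases hp2.eq_or_lt with rfl | hp2
  · have hq2 : q = 2 := by rw [hq]; norm_num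
    have hb : b = 2 := by linarith
    subst hb
    have hbessel := tsum_enorm_fourierCoefficient_sq_le hu hf.1
    simp only [hq2, sub_self, ENNReal.rpow_zero, mul_one, ENNReal.rpow_two]
    refine (ENNReal.rpow_le_rpow hbessel (by norm_num)).trans (le_mul_of_one_le_left zero_le ?_)
    rw [ENNReal.one_le_ofReal]
    exact le_sup_left.trans le_sup_left
  -- The truncation sets must be measurable, so f is replaced by a measurable representative.
  · set g := hf.1.aemeasurable.mk f
    have hfg : f =ᵐ[volume] g := hf.1.aemeasurable.ae_eq_mk
    have hgm : Measurable g := hf.1.aemeasurable.measurable_mk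
    have hg : MemLp g (ENNReal.ofReal p) volume := hf.ae_eq hfg
    have hN : ∫⁻ x, ‖f x‖ₑ ^ p = ∫⁻ x, ‖g x‖ₑ ^ p :=
      lintegral_congr_ae (by filter_upwards [hfg] with x hx; rw [hx])
    simp_rw [hN, fun j => fourierCoefficient_congr (u j) hfg]
    refine tsum_paley_interpolation_le hp1 hp2 hq hpb hbq (fun j => by simp)
      (fun j => supNorm_ne_zero_of_norm_eq_one (hu.1 j)) (fun j => (hB j).ne)
      ?_ ?_ ?_
    · rw [ENNReal.one_le_ofReal]
      exact le_sup_left.trans le_sup_left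
    · refine (tsum_paley_le hp1 hp2 hu hB hφ (paleyConstant_ne_zero hu hφ) hM.ne hgm hg).trans ?_
      gcongr
      exact le_sup_right.trans le_sup_left
    · refine (tsum_hausdorffYoung_le hp1 hp2 hq hu hB hgm hg).trans ?_
      gcongr
      exact le_sup_right
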